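/- Let $(\Omega,\mathcal F,\mathbb P)$ be a probability space and $\mathbb X$ a measurable space, let $k:\mathbb X\times\mathbb X\to\mathbb R$ be a measurable (symmetric) positive semidefinite kernel, let $\sigma>0$ and $N\ge 1$, and let $x_1,\dots,x_N$ be independent and identically distributed $\mathbb X$-valued random variables on $\Omega$. Put $K_N=(k(x_i,x_j))_{i,j\le N}$ and $A=K_N+\sigma^2 I_N$, and let $C$ be the Cholesky factor of $A$, i.e. the unique lower triangular matrix with positive diagonal such that $CC^{\top}=A$. Let $\mathcal F_j=\sigma(x_1,\dots,x_j)$ be the canonical filtration, $f_j=2\log C_{jj}$, $D_n=\sum_{j=1}^n f_j$ and $L^-=\log\sigma^2$, and assume that $L^+\in\mathbb R$ is a constant with $$\max_{j=1,\dots,N}\log\bigl(k(x_j,x_j)+\sigma^2\bigr)\le L^+\quad\text{almost surely.}$$ Let $r,\delta\in(0,1)$. Put $$H_N(x)=\mathbf 1_{\{x\le N\}}\sqrt{\Bigl(\tfrac{N}{N+x}\Bigr)^{N+x}\Bigl(\tfrac{N}{N-x}\Bigr)^{N-x}}\quad(x\ge0,\ \text{the second factor being }1\text{ at }x=N),$$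 $$H_N^{-1}(p)=\inf\{x\ge 0: H_N(x)\le p\},\qquad c_\delta=(L^+-L^-)\,H_N^{-1}(\delta/2),$$ and for $1\le n\le N$ $$\mathcal L_n=D_n+(N-n)L^-,\qquad \mathcal U_n=D_n+\min\Bigl(c_\delta+(N-n)\tfrac{D_n+c_\delta}{n},\ (N-n)L^+\Bigr),\qquad \hat D_n=\tfrac12(\mathcal L_n+\mathcal U_n).$$ Let $\tau$ be the smallest $n\in\{1,\dots,N-1\}$ such that $$\operatorname{sign}(\mathcal U_n)=\operatorname{sign}(\mathcal L_n)\ne 0\quad\text{and}\quad \frac{\mathcal U_n-\mathcal L_n}{2\min(|\mathcal U_n|,|\mathcal L_n|)}\le r,$$ and $\tau=N$ if there is no such $n$. Then $\tau$ is a stopping time with respect to $(\mathcal F_n)$, and $\hat D_\tau$ estimates $\log\det A$ to relative error $r$ with probability at least $1-\delta$: $$\mathbb P\bigl(|\log\det A-\hat D_\tau|>r\,|\log\det A|\bigr)\le\delta .$$ -/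

import Mathlib

open MeasureTheory ProbabilityTheory
open scoped Matrix

/-! ### Cholesky decomposition -/

/-- `C` is a Cholesky factor of `A`: it is lower triangular, has positive diagonal entries,
and satisfies `C * Cᵀ = A`. -/
structure IsCholeskyFactor {N : ℕ} (A C : Matrix (Fin N) (Fin N) ℝ) : Prop where
  lower : ∀ i j : Fin N, i < j → C i j = 0
  diag_pos : ∀ i : Fin N, 0 < C i i
  mul_transpose : C * Cᵀ = A

/-- Every positive definite matrix has a Cholesky factor. -/
theorem exists_isCholeskyFactor {N : ℕ} {A : Matrix (Fin N) (Fin N) ℝ} (hA : A.PosDef) :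
    ∃ C, IsCholeskyFactor A C := by
  have htri : (LDL.lowerInv hA).BlockTriangular OrderDual.toDual :=
    fun i j hij => LDL.lowerInv_triangular hA hij
  have hLtri : (LDL.lower hA).BlockTriangular OrderDual.toDual :=
    Matrix.blockTriangular_inv_of_blockTriangular htri
  have hdet : (LDL.lower hA).det ≠ 0 := by
    have h1 : IsUnit (LDL.lowerInv hA).det :=
      (Matrix.isUnit_iff_isUnit_det _).1 (isUnit_of_invertible _)
    rw [LDL.lower, Matrix.det_nonsing_inv]
    exact (h1.ringInverse).ne_zero
  have hLdiag : ∀ i, LDL.lower hA i i ≠ 0 := by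
    rw [Matrix.det_of_isLowerTriangular _ hLtri] at hdet
    exact fun i => Finset.prod_ne_zero_iff.1 hdet i (Finset.mem_univ i)
  have hfac := LDL.lower_conj_diag hA
  have hDpos : ∀ i, 0 < LDL.diagEntries hA i := by
    have hu : IsUnit (LDL.lowerInv hA) := isUnit_of_invertible _
    have h : (LDL.diag hA).PosDef := by
      rw [LDL.diag_eq_lowerInv_conj]
      exact hA.mul_mul_conjTranspose_same (Matrix.vecMul_injective_iff_isUnit.2 hu)
    intro i
    have := h.diag_pos (i := i)
    simpa [LDL.diag] using this
  refine ⟨LDL.lower hA * Matrix.diagonal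
    (fun i => Real.sign (LDL.lower hA i i) * √(LDL.diagEntries hA i)), ?_, ?_, ?_⟩
  · intro i j hij
    rw [Matrix.mul_diagonal, hLtri hij, zero_mul]
  · intro i
    rw [Matrix.mul_diagonal, ← mul_assoc]
    refine mul_pos ?_ (Real.sqrt_pos.2 (hDpos i))
    rcases lt_or_gt_of_ne (hLdiag i) with h | h
    · rw [Real.sign_of_neg h]; linarith
    · rw [Real.sign_of_pos h]; linarith
  · rw [Matrix.transpose_mul, Matrix.diagonal_transpose, ← Matrix.mul_assoc,
      Matrix.mul_assoc (LDL.lower hA), Matrix.diagonal_mul_diagonal]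
    have hd : (fun i => Real.sign (LDL.lower hA i i) * √(LDL.diagEntries hA i) *
        (Real.sign (LDL.lower hA i i) * √(LDL.diagEntries hA i))) = LDL.diagEntries hA := by
      funext i
      rw [mul_mul_mul_comm, Real.mul_self_sqrt (hDpos i).le]
      rcases lt_or_gt_of_ne (hLdiag i) with h | h
      · rw [Real.sign_of_neg h]; ring
      · rw [Real.sign_of_pos h]; ring
    rw [hd]
    simpa [LDL.diag, Matrix.conjTranspose_eq_transpose_of_trivial] using hfac

/-- A matrix has at most one Cholesky factor. -/
theorem IsCholeskyFactor.unique {N : ℕ} {A C D : Matrix (Fin N) (Fin N) ℝ}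
    (hC : IsCholeskyFactor A C) (hD : IsCholeskyFactor A D) : C = D := by
  have key : ∀ (E : Matrix (Fin N) (Fin N) ℝ), IsCholeskyFactor A E → ∀ i j : Fin N, j ≤ i →
      A i j = ∑ k ∈ Finset.univ.filter (· < j), E i k * E j k + E i j * E j j := by
    intro E hE i j _
    rw [← hE.mul_transpose, Matrix.mul_apply]
    simp only [Matrix.transpose_apply]
    rw [← Finset.sum_filter_add_sum_filter_not Finset.univ (· < j)]
    congr 1
    refine Finset.sum_eq_single_of_mem j (by simp) ?_
    intro k hk hkj
    have hlt : j < k := by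
      have := (Finset.mem_filter.1 hk).2
      exact lt_of_le_of_ne (not_lt.1 this) (Ne.symm hkj)
    rw [hE.lower j k hlt, mul_zero]
  have main : ∀ n : ℕ, ∀ j : Fin N, (j : ℕ) = n → ∀ i, C i j = D i j := by
    intro n
    induction n using Nat.strong_induction_on with
    | _ n ih =>
      intro j hj
      have hcol : ∀ i, ∀ k < j, C i k = D i k := fun i k hk =>
        ih k (hj ▸ hk) k rfl i
      have hsum : ∀ i, ∑ k ∈ Finset.univ.filter (· < j), C i k * C j k
          = ∑ k ∈ Finset.univ.filter (· < j), D i k * D j k := fun i =>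
        Finset.sum_congr rfl fun k hk => by
          have hk' := (Finset.mem_filter.1 hk).2
          rw [hcol i k hk', hcol j k hk']
      have hmul : ∀ i, j ≤ i → C i j * C j j = D i j * D j j := fun i hij => by
        have h1 := key C hC i j hij
        have h2 := key D hD i j hij
        rw [hsum i] at h1
        linarith
      have hjj : C j j = D j j := by
        have h := hmul j le_rfl
        exact (mul_self_inj (hC.diag_pos j).le (hD.diag_pos j).le).1 h
      intro i
      rcases lt_or_ge i j with hij | hij
      · rw [hC.lower i j hij, hD.lower i j hij]
      · have h := hmul i hij
        rw [hjj] at h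
        exact mul_right_cancel₀ (hD.diag_pos j).ne' h
  ext i j
  exact main j j rfl i

open Classical in
/-- The Cholesky factor of `A` (set to `0` if `A` has none; see `isCholeskyFactor_cholesky`). -/
noncomputable def cholesky {N : ℕ} (A : Matrix (Fin N) (Fin N) ℝ) : Matrix (Fin N) (Fin N) ℝ :=
  if h : ∃ C, IsCholeskyFactor A C then h.choose else 0

theorem isCholeskyFactor_cholesky {N : ℕ} {A : Matrix (Fin N) (Fin N) ℝ} (hA : A.PosDef) :
    IsCholeskyFactor A (cholesky A) := by
  have h := exists_isCholeskyFactor hA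
  rw [cholesky, dif_pos h]
  exact h.choose_spec

/-! ### Kernel matrices -/

/-- The matrix `K_N + σ² I_N`, where `(K_N)_{ij} = k (x_i) (x_j)`. -/
def regularizedKernelMatrix {𝕏 : Type*} {N : ℕ} (k : 𝕏 → 𝕏 → ℝ) (σ : ℝ) (x : Fin N → 𝕏) :
    Matrix (Fin N) (Fin N) ℝ :=
  Matrix.of (fun i j => k (x i) (x j)) + σ ^ 2 • (1 : Matrix (Fin N) (Fin N) ℝ)

/-! ### The stopping rule for a finite sum of real numbers

Indices are shifted by one: the summands `f_1, …, f_N` are `f 0, …, f (N - 1)`. -/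

/-- `D_n`, the sum of the first `n` summands. -/
def partialSum {N : ℕ} (f : Fin N → ℝ) (n : ℕ) : ℝ :=
  ∑ j ∈ Finset.univ.filter (fun j : Fin N => (j : ℕ) < n), f j

/-- The function `H_N` on `[0, ∞)`. -/
noncomputable def tailBound (N : ℕ) (x : ℝ) : ℝ :=
  if x ≤ N then
    √(((N : ℝ) / (N + x)) ^ ((N : ℝ) + x) * ((N : ℝ) / (N - x)) ^ ((N : ℝ) - x))
  else 0

/-- The generalized inverse of the function `H_N`, which is decreasing on `[0, ∞)`. -/
noncomputable def tailBoundInv (N : ℕ) (p : ℝ) : ℝ :=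
  sInf {x : ℝ | 0 ≤ x ∧ tailBound N x ≤ p}

/-- The constant `c_δ`; here `a` and `b` are the lower and the upper bound of the summands. -/
noncomputable def slack (N : ℕ) (a b δ : ℝ) : ℝ :=
  (b - a) * tailBoundInv N (δ / 2)

/-- The lower bound `L_n` for the whole sum after `n` summands. -/
def lowerBound {N : ℕ} (a : ℝ) (f : Fin N → ℝ) (n : ℕ) : ℝ :=
  partialSum f n + ((N : ℝ) - n) * a

/-- The upper bound `U_n` for the whole sum after `n` summands. -/
noncomputable def upperBound {N : ℕ} (a b δ : ℝ) (f : Fin N → ℝ) (n : ℕ) : ℝ :=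
  partialSum f n +
    min (slack N a b δ + ((N : ℝ) - n) * ((partialSum f n + slack N a b δ) / n))
      (((N : ℝ) - n) * b)

/-- The estimator `(L_n + U_n) / 2`. -/
noncomputable def estimator {N : ℕ} (a b δ : ℝ) (f : Fin N → ℝ) (n : ℕ) : ℝ :=
  (lowerBound a f n + upperBound a b δ f n) / 2

/-- The sign condition and the relative precision condition at step `n`. -/
def StopCondition {N : ℕ} (a b δ r : ℝ) (f : Fin N → ℝ) (n : ℕ) : Prop :=
  (SignType.sign (upperBound a b δ f n) = SignType.sign (lowerBound a f n) ∧
    SignType.sign (lowerBound a f n) ≠ 0) ∧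
  (upperBound a b δ f n - lowerBound a f n) /
    (2 * min |upperBound a b δ f n| |lowerBound a f n|) ≤ r

/-- The step at which the computation stops: the first `1 ≤ n < N` at which the stopping
condition holds, and `N` if there is none. -/
noncomputable def stoppingStep {N : ℕ} (a b δ r : ℝ) (f : Fin N → ℝ) : ℕ :=
  sInf {n : ℕ | n = N ∨ (1 ≤ n ∧ n < N ∧ StopCondition a b δ r f n)}

/-! ### The canonical filtration -/

/-- The filtration `F_n = σ(x_1, …, x_n)` (with `F_0` trivial and `F_n = F_N` for `n ≥ N`). -/
def canonicalFiltration {Ω 𝕏 : Type*} [mΩ : MeasurableSpace Ω] [m𝕏 : MeasurableSpace 𝕏] {N : ℕ}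
    (x : Fin N → Ω → 𝕏) (hx : ∀ j, Measurable (x j)) : Filtration ℕ mΩ where
  seq n := ⨆ (j : Fin N) (_ : (j : ℕ) < n), MeasurableSpace.comap (x j) m𝕏
  mono' _ _ hmn := iSup_mono fun _ => iSup_mono' fun h => ⟨h.trans_le hmn, le_rfl⟩
  le' _ := iSup₂_le fun j _ => (hx j).comap_le

/-! ### The objects for the log-determinant -/

/-- The summands `f_j = 2 log C_jj`, where `C` is the Cholesky factor of `K_N + σ² I_N`. -/
noncomputable def logDetSummand {𝕏 : Type*} {N : ℕ} (k : 𝕏 → 𝕏 → ℝ) (σ : ℝ) (x : Fin N → 𝕏)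
    (j : Fin N) : ℝ :=
  2 * Real.log (cholesky (regularizedKernelMatrix k σ x) j j)

/-- The step `τ` at which the stopped Cholesky decomposition of `K_N + σ² I_N` stops. -/
noncomputable def logDetStoppingStep {𝕏 : Type*} {N : ℕ} (k : 𝕏 → 𝕏 → ℝ) (σ b δ r : ℝ)
    (x : Fin N → 𝕏) : ℕ :=
  stoppingStep (Real.log (σ ^ 2)) b δ r (logDetSummand k σ x)

/-- The estimate of `log det (K_N + σ² I_N)` at the stopping step `τ`. -/
noncomputable def logDetEstimate {𝕏 : Type*} {N : ℕ} (k : 𝕏 → 𝕏 → ℝ) (σ b δ r : ℝ)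
    (x : Fin N → 𝕏) : ℝ :=
  estimator (Real.log (σ ^ 2)) b δ (logDetSummand k σ x) (logDetStoppingStep k σ b δ r x)

/-! The log-determinant is the full sum `D_N` of the `f_j`, so everything rests on bracketing `D_N`
by the bounds at the stopping step. The pivot `C_jj²` is the minimum of the quadratic form of `A`
over vectors with `j`-th coordinate `1` that vanish beyond `j`. This gives `log σ² ≤ f_j ≤ log
(k(x_j, x_j) + σ²)`, hence the lower bound. It also shows that conditioning on more points can only
lower a pivot. Since the points are i.i.d., the conditional means `m_j` of `f_j` given the past
therefore decrease (`logDetSummand_le_logDetSummand`, `condExp_logDetSummand_le`).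

The sums `M_n` of `f_j - m_j` form a martingale with increments at most `L⁺ - L⁻` in absolute value.
Hoeffding's inequality in the sharp form `H_N`, applied to suitably stopped or started versions of
`M`, shows that `-M_n ≤ c_δ` for all `n` and `M_N - M_τ ≤ c_δ`, each outside an event of probability
at most `δ/2`. When both hold, the last observed mean is at most the average `(D_τ + c_δ)/τ`, and it
bounds all later means, so `D_N ≤ U_τ`. The stopping rule then turns `L_τ ≤ D_N ≤ U_τ` into the
relative error bound for the midpoint. -/

namespace IsCholeskyFactor

/-! ### Cholesky pivots as minima of quadratic forms -/

variable {N : ℕ} {A C : Matrix (Fin N) (Fin N) ℝ}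

theorem blockTriangular (h : IsCholeskyFactor A C) : C.BlockTriangular OrderDual.toDual :=
  fun _ _ hij => h.lower _ _ hij

theorem det_factor (h : IsCholeskyFactor A C) : C.det = ∏ i, C i i :=
  Matrix.det_of_isLowerTriangular _ h.blockTriangular

theorem isUnit_det (h : IsCholeskyFactor A C) : IsUnit C.det := by
  rw [h.det_factor]
  exact (Finset.prod_pos fun i _ => h.diag_pos i).ne'.isUnit

theorem log_det (h : IsCholeskyFactor A C) :
    Real.log A.det = ∑ i, 2 * Real.log (C i i) := by
  rw [← h.mul_transpose, Matrix.det_mul, Matrix.det_transpose, ← sq, Real.log_pow, h.det_factor,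
    Real.log_prod fun i _ => (h.diag_pos i).ne', Finset.mul_sum]
  norm_num

theorem dotProduct_mulVec (h : IsCholeskyFactor A C) (v : Fin N → ℝ) :
    v ⬝ᵥ A *ᵥ v = (Cᵀ *ᵥ v) ⬝ᵥ (Cᵀ *ᵥ v) := by
  rw [← h.mul_transpose, ← Matrix.mulVec_mulVec, Matrix.dotProduct_mulVec,
    ← Matrix.mulVec_transpose]

/-- The form equals `|Cᵀ v|²`, and triangularity leaves only `C j j` in the `j`-th coordinate of `Cᵀ
v`. Together with `exists_dotProduct_mulVec_eq`, this identifies `C j j ^ 2` as a constrained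
minimum. -/
theorem sq_diag_le (h : IsCholeskyFactor A C) {j : Fin N} {v : Fin N → ℝ} (hj : v j = 1)
    (hv : ∀ i, j < i → v i = 0) : C j j ^ 2 ≤ v ⬝ᵥ A *ᵥ v := by
  have h1 : (Cᵀ *ᵥ v) j = C j j := by
    rw [Matrix.mulVec, dotProduct, Finset.sum_eq_single j]
    · simp [hj]
    · intro i _ hij
      rcases lt_or_gt_of_ne hij with hlt | hlt
      · simp [h.lower i j hlt]
      · simp [hv i hlt]
    · simp
  rw [h.dotProduct_mulVec, dotProduct, ← h1, sq]
  exact Finset.single_le_sum (f := fun i => (Cᵀ *ᵥ v) i * (Cᵀ *ᵥ v) i)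
    (fun i _ => mul_self_nonneg _) (Finset.mem_univ j)

theorem exists_dotProduct_mulVec_eq (h : IsCholeskyFactor A C) (j : Fin N) :
    ∃ v : Fin N → ℝ, v j = 1 ∧ (∀ i, j < i → v i = 0) ∧ v ⬝ᵥ A *ᵥ v = C j j ^ 2 := by
  have hu := h.isUnit_det
  have : Invertible C := C.invertibleOfIsUnitDet hu
  have htri : C⁻¹.BlockTriangular OrderDual.toDual :=
    Matrix.blockTriangular_inv_of_blockTriangular h.blockTriangular
  have hdiag : C j j * C⁻¹ j j = 1 := by
    have h1 : (C * C⁻¹) j j = 1 := by rw [Matrix.mul_nonsing_inv _ hu, Matrix.one_apply_eq]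
    rw [Matrix.mul_apply, Finset.sum_eq_single j] at h1
    · exact h1
    · intro i _ hij
      rcases lt_or_gt_of_ne hij with hlt | hlt
      · rw [htri hlt, mul_zero]
      · rw [h.lower j i hlt, zero_mul]
    · simp
  -- The minimizer solves `Cᵀ v = C j j • e_j`: it is row `j` of `C⁻¹`, scaled to have `j`-th entry
  -- `1`.
  refine ⟨fun i => C j j * C⁻¹ j i, hdiag, fun i hi => ?_, ?_⟩
  · simp only [htri hi, mul_zero]
  · have h1 : Cᵀ *ᵥ (fun i => C j j * C⁻¹ j i) = C j j • Pi.single j 1 := by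
      ext l
      have h2 : (C⁻¹ * C) j l = (1 : Matrix (Fin N) (Fin N) ℝ) j l := by
        rw [Matrix.nonsing_inv_mul _ hu]
      rw [Matrix.mul_apply] at h2
      simp only [Matrix.mulVec, dotProduct, Matrix.transpose_apply, Pi.smul_apply, smul_eq_mul]
      rw [Matrix.one_apply] at h2
      simp only [Pi.single_apply, eq_comm (a := l) (b := j)]
      rw [← h2, Finset.mul_sum]
      exact Finset.sum_congr rfl fun i _ => by ring
    rw [h.dotProduct_mulVec, h1]
    simp [sq]

theorem sq_diag_le_apply (h : IsCholeskyFactor A C) (j : Fin N) : C j j ^ 2 ≤ A j j := by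
  have h1 := h.sq_diag_le (j := j) (v := Pi.single j 1) (by simp)
    (fun i hi => Pi.single_eq_of_ne hi.ne' _)
  simpa using h1

theorem apply_eq (h : IsCholeskyFactor A C) (i j : Fin N) :
    A i j = ∑ l ∈ Finset.univ.filter (· < j), C i l * C j l + C i j * C j j := by
  rw [← h.mul_transpose, Matrix.mul_apply]
  simp only [Matrix.transpose_apply]
  rw [← Finset.sum_filter_add_sum_filter_not Finset.univ (· < j)]
  congr 1
  refine Finset.sum_eq_single_of_mem j (by simp) fun l hl hlj => ?_
  rw [h.lower j l (lt_of_le_of_ne (not_lt.1 (Finset.mem_filter.1 hl).2) (Ne.symm hlj)), mul_zero]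

theorem diag_eq_sqrt (h : IsCholeskyFactor A C) (j : Fin N) :
    C j j = √(A j j - ∑ l ∈ Finset.univ.filter (· < j), C j l * C j l) := by
  rw [h.apply_eq j j, add_sub_cancel_left, Real.sqrt_mul_self (h.diag_pos j).le]

theorem eq_div (h : IsCholeskyFactor A C) (i j : Fin N) :
    C i j = (A i j - ∑ l ∈ Finset.univ.filter (· < j), C i l * C j l) / C j j := by
  rw [h.apply_eq i j, add_sub_cancel_left, mul_div_cancel_right₀ _ (h.diag_pos j).ne']

end IsCholeskyFactor

/-- Induction over columns through the Cholesky recursion. Only entries of the leading block up to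
`n` are used, which is what makes the pivots adapted. -/
theorem measurable_cholesky_apply {α : Type*} [MeasurableSpace α] {N : ℕ}
    {A : α → Matrix (Fin N) (Fin N) ℝ} (hA : ∀ a, (A a).PosDef) {n : Fin N}
    (hm : ∀ i j, i ≤ n → j ≤ n → Measurable fun a => A a i j) (i j : Fin N) (hi : i ≤ n)
    (hj : j ≤ n) : Measurable fun a => cholesky (A a) i j := by
  induction j using WellFoundedLT.induction generalizing i with
  | ind j ih =>
    have hsum : ∀ i ≤ n, Measurable fun a => ∑ l ∈ Finset.univ.filter (· < j),
        cholesky (A a) i l * cholesky (A a) j l := fun i hi =>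
      Finset.measurable_sum _ fun l hl =>
        have hlj := (Finset.mem_filter.1 hl).2
        (ih l hlj i hi (hlj.le.trans hj)).mul (ih l hlj j hj (hlj.le.trans hj))
    have hdiag : Measurable fun a => cholesky (A a) j j := by
      simp only [fun a => (isCholeskyFactor_cholesky (hA a)).diag_eq_sqrt j]
      exact ((hm j j hj hj).sub (hsum j hj)).sqrt
    simp only [fun a => (isCholeskyFactor_cholesky (hA a)).eq_div i j]
    exact ((hm i j hi hj).sub (hsum i hi)).div hdiag

/-! ### Bounds and monotonicity of the log-pivots -/

section Kernel

variable {𝕏 : Type*} {N : ℕ} {k : 𝕏 → 𝕏 → ℝ} {σ : ℝ}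

theorem regularizedKernelMatrix_apply (x : Fin N → 𝕏) (i j : Fin N) :
    regularizedKernelMatrix k σ x i j = k (x i) (x j) + if i = j then σ ^ 2 else 0 := by
  simp [regularizedKernelMatrix, Matrix.one_apply]

theorem dotProduct_regularizedKernelMatrix_mulVec (x : Fin N → 𝕏) (v : Fin N → ℝ) :
    v ⬝ᵥ regularizedKernelMatrix k σ x *ᵥ v =
      ∑ i, ∑ j, v i * v j * regularizedKernelMatrix k σ x i j := by
  simp only [dotProduct, Matrix.mulVec, Finset.mul_sum]
  exact Finset.sum_congr rfl fun i _ => Finset.sum_congr rfl fun j _ => by ring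

theorem le_dotProduct_regularizedKernelMatrix_mulVec
    (hk : (Matrix.of k).PosSemidef) (x : Fin N → 𝕏) (v : Fin N → ℝ) :
    σ ^ 2 * (v ⬝ᵥ v) ≤ v ⬝ᵥ regularizedKernelMatrix k σ x *ᵥ v := by
  have h := (hk.submatrix x).dotProduct_mulVec_nonneg v
  have h1 : (Matrix.of k).submatrix x x = Matrix.of fun i j => k (x i) (x j) := rfl
  rw [h1, star_trivial] at h
  rw [regularizedKernelMatrix, Matrix.add_mulVec, dotProduct_add, Matrix.smul_mulVec,
    Matrix.one_mulVec, dotProduct_smul, smul_eq_mul]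
  linarith

theorem posDef_regularizedKernelMatrix
    (hk : (Matrix.of k).PosSemidef) (hσ : 0 < σ) (x : Fin N → 𝕏) :
    (regularizedKernelMatrix k σ x).PosDef :=
  Matrix.PosDef.posSemidef_add (hk.submatrix x) (Matrix.PosDef.one.smul (by positivity))

theorem isCholeskyFactor_regularizedKernelMatrix
    (hk : (Matrix.of k).PosSemidef) (hσ : 0 < σ) (x : Fin N → 𝕏) :
    IsCholeskyFactor (regularizedKernelMatrix k σ x) (cholesky (regularizedKernelMatrix k σ x)) :=
  isCholeskyFactor_cholesky (posDef_regularizedKernelMatrix hk hσ x)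

theorem log_det_regularizedKernelMatrix
    (hk : (Matrix.of k).PosSemidef) (hσ : 0 < σ) (x : Fin N → 𝕏) :
    Real.log (regularizedKernelMatrix k σ x).det = partialSum (logDetSummand k σ x) N := by
  rw [(isCholeskyFactor_regularizedKernelMatrix hk hσ x).log_det, partialSum,
    Finset.filter_true_of_mem fun i _ => i.2]
  rfl

theorem logDetSummand_eq (x : Fin N → 𝕏) (j : Fin N) :
    logDetSummand k σ x j = Real.log (cholesky (regularizedKernelMatrix k σ x) j j ^ 2) := by
  rw [Real.log_pow, logDetSummand]
  norm_num

theorem le_logDetSummand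
    (hk : (Matrix.of k).PosSemidef) (hσ : 0 < σ) (x : Fin N → 𝕏) (j : Fin N) :
    Real.log (σ ^ 2) ≤ logDetSummand k σ x j := by
  have hC := isCholeskyFactor_regularizedKernelMatrix hk hσ x
  obtain ⟨v, hvj, -, hv⟩ := hC.exists_dotProduct_mulVec_eq j
  rw [logDetSummand_eq, ← hv]
  refine Real.log_le_log (by positivity)
    (le_trans ?_ (le_dotProduct_regularizedKernelMatrix_mulVec hk x v))
  refine le_mul_of_one_le_right (by positivity) ?_
  have h1 : v j * v j ≤ v ⬝ᵥ v :=
    Finset.single_le_sum (f := fun i => v i * v i) (fun i _ => mul_self_nonneg _)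
      (Finset.mem_univ j)
  simpa [hvj] using h1

theorem logDetSummand_le
    (hk : (Matrix.of k).PosSemidef) (hσ : 0 < σ) (x : Fin N → 𝕏) (j : Fin N) :
    logDetSummand k σ x j ≤ Real.log (k (x j) (x j) + σ ^ 2) := by
  have hC := isCholeskyFactor_regularizedKernelMatrix hk hσ x
  have h1 := hC.sq_diag_le_apply j
  have h2 := hC.diag_pos j
  rw [regularizedKernelMatrix_apply, if_pos rfl] at h1
  rw [logDetSummand_eq]
  exact Real.log_le_log (by positivity) h1

/-- The point `x i` is placed at the later position `j`, after more predecessors. Transposing `i`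
and `j` carries the minimizer for `x` at `i` to an admissible vector for `y` at `j` with the same
quadratic form, so the minimum can only drop. -/
theorem logDetSummand_le_logDetSummand (hk : (Matrix.of k).PosSemidef) (hσ : 0 < σ)
    {x y : Fin N → 𝕏} {i j : Fin N} (hij : i ≤ j)
    (hxy : ∀ l, l < i → y l = x l) (hj : y j = x i) :
    logDetSummand k σ y j ≤ logDetSummand k σ x i := by
  have hx := isCholeskyFactor_regularizedKernelMatrix hk hσ x
  have hy := isCholeskyFactor_regularizedKernelMatrix hk hσ y
  have hpos := hy.diag_pos j
  obtain ⟨v, hvi, hv0, hv⟩ := hx.exists_dotProduct_mulVec_eq i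
  rw [logDetSummand_eq, logDetSummand_eq, ← hv]
  refine Real.log_le_log (by positivity) ?_
  set s : Equiv.Perm (Fin N) := Equiv.swap i j with hs
  have hsy : ∀ l, v l ≠ 0 → y (s l) = x l := by
    intro l hl
    have hli : l ≤ i := not_lt.1 fun h => hl (hv0 l h)
    rcases hli.eq_or_lt with rfl | hlt
    · rw [hs, Equiv.swap_apply_left, hj]
    · rw [hs, Equiv.swap_apply_of_ne_of_ne hlt.ne (hlt.trans_le hij).ne, hxy l hlt]
  refine (hy.sq_diag_le (j := j) (v := fun l => v (s l)) ?_ ?_).trans_eq ?_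
  · simp [hs, hvi]
  · intro l hl
    refine hv0 _ ?_
    rw [hs, Equiv.swap_apply_of_ne_of_ne (hij.trans_lt hl).ne' hl.ne']
    exact hij.trans_lt hl
  · rw [dotProduct_regularizedKernelMatrix_mulVec, dotProduct_regularizedKernelMatrix_mulVec,
      ← Equiv.sum_comp s]
    refine Finset.sum_congr rfl fun a _ => ?_
    rw [← Equiv.sum_comp s]
    refine Finset.sum_congr rfl fun b _ => ?_
    have hss : ∀ l, s (s l) = l := Equiv.swap_apply_self i j
    rw [hss, hss]
    -- The points are matched only on the support of `v`; elsewhere both terms vanish.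
    by_cases ha : v a = 0
    · simp [ha]
    by_cases hb : v b = 0
    · simp [hb]
    rw [regularizedKernelMatrix_apply, regularizedKernelMatrix_apply, hsy a ha, hsy b hb]
    simp only [s.injective.eq_iff]

theorem measurable_logDetSummand {α : Type*} [MeasurableSpace α] [MeasurableSpace 𝕏]
    (hk : (Matrix.of k).PosSemidef) (hσ : 0 < σ) (hk_meas : Measurable (Function.uncurry k))
    {x : α → Fin N → 𝕏} {j : Fin N}
    (hx : ∀ i, i ≤ j → Measurable fun a => x a i) :
    Measurable fun a => logDetSummand k σ (x a) j := by
  refine (Real.measurable_log.comp (measurable_cholesky_apply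
    (fun a => posDef_regularizedKernelMatrix hk hσ (x a)) (n := j) (fun p q hp hq => ?_)
    j j le_rfl le_rfl)).const_mul 2
  simp only [regularizedKernelMatrix_apply]
  exact (hk_meas.comp ((hx p hp).prodMk (hx q hq))).add_const _

end Kernel

/-! ### Partial sums and indicator weights -/

section PartialSum

variable {N : ℕ}

@[simp]
theorem partialSum_zero (f : Fin N → ℝ) : partialSum f 0 = 0 := by
  simp [partialSum]

theorem partialSum_succ (f : Fin N → ℝ) {n : ℕ} (hn : n < N) :
    partialSum f (n + 1) = partialSum f n + f ⟨n, hn⟩ := by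
  have h : Finset.univ.filter (fun j : Fin N => (j : ℕ) < n + 1) =
      insert ⟨n, hn⟩ (Finset.univ.filter fun j : Fin N => (j : ℕ) < n) := by
    ext j
    simp only [Finset.mem_filter, Finset.mem_univ, true_and, Finset.mem_insert, Fin.ext_iff]
    omega
  rw [partialSum, h, Finset.sum_insert (by simp), add_comm, partialSum]

theorem partialSum_ite_lt (f : Fin N → ℝ) {n : ℕ} :
    partialSum (fun j => (if (j : ℕ) < n then 1 else 0) * f j) N = partialSum f n := by
  simp [partialSum, Finset.sum_filter]

theorem partialSum_ite_ge (f : Fin N → ℝ) {n : ℕ} :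
    partialSum (fun j => (if n ≤ (j : ℕ) then 1 else 0) * f j) N =
      partialSum f N - partialSum f n := by
  rw [eq_sub_iff_add_eq, ← partialSum_ite_lt f (n := n)]
  simp only [partialSum, ← Finset.sum_add_distrib, ← add_mul]
  refine Finset.sum_congr rfl fun j _ => ?_
  rcases lt_or_ge (j : ℕ) n with h | h
  · simp [h, h.not_ge]
  · simp [h, h.not_gt]

theorem partialSum_sub (f g : Fin N → ℝ) (n : ℕ) :
    partialSum (fun j => f j - g j) n = partialSum f n - partialSum g n := by
  simp [partialSum]

theorem partialSum_neg (f : Fin N → ℝ) (n : ℕ) :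
    partialSum (fun j => -f j) n = -partialSum f n := by
  simp [partialSum]

theorem partialSum_const_mul (c : ℝ) (f : Fin N → ℝ) (n : ℕ) :
    partialSum (fun j => c * f j) n = c * partialSum f n := by
  simp [partialSum, Finset.mul_sum]

theorem stronglyMeasurable_partialSum {α : Type*} {m : MeasurableSpace α} {f : Fin N → α → ℝ}
    {n : ℕ} (hf : ∀ j : Fin N, (j : ℕ) < n → StronglyMeasurable[m] (f j)) :
    StronglyMeasurable[m] fun a => partialSum (fun j => f j a) n := by
  simp only [partialSum]
  exact Finset.stronglyMeasurable_fun_sum _ fun j hj => hf j (Finset.mem_filter.1 hj).2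

end PartialSum

/-! ### Optimizing the Chernoff bound -/

section TailBound

variable {N : ℕ}

/-- The exponent `-l y + N log cosh l` is stationary where `tanh l = y / N`. -/
theorem exp_mul_cosh_artanh_pow_eq_tailBound {y : ℝ} (hy : 0 ≤ y) (hyN : y < N) :
    Real.exp (-Real.artanh (y / N) * y) * Real.cosh (Real.artanh (y / N)) ^ N =
      tailBound N y := by
  have hN : (0 : ℝ) < N := hy.trans_lt hyN
  set t : ℝ := y / N with ht
  have hyt : y = N * t := by rw [ht]; field_simp
  have ht0 : 0 ≤ t := by positivity
  have ht1 : t < 1 := by rwa [ht, div_lt_one hN]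
  have h1 : 0 < 1 - t := by linarith
  have h2 : 0 < 1 + t := by linarith
  have hlog1 : (N : ℝ) / (N + y) = (1 + t)⁻¹ := by rw [hyt]; field_simp
  have hlog2 : (N : ℝ) / (N - y) = (1 - t)⁻¹ := by
    rw [hyt, ← mul_one_sub, div_mul_cancel_left₀ hN.ne']
  rw [tailBound, if_pos hyN.le, hlog1, hlog2, eq_comm,
    Real.sqrt_eq_iff_eq_sq (by positivity) (by positivity [Real.cosh_pos (Real.artanh t)])]
  have hmem : t ∈ Set.Ioo (-1 : ℝ) 1 := ⟨by linarith, ht1⟩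
  have hcosh : Real.cosh (Real.artanh t) ^ 2 =
      Real.exp (-(Real.log (1 + t) + Real.log (1 - t))) := by
    rw [Real.cosh_artanh hmem, div_pow, Real.sq_sqrt (by nlinarith), Real.exp_neg, Real.exp_add,
      Real.exp_log h2, Real.exp_log h1, one_pow, one_div]
    congr 1
    ring
  rw [mul_pow, ← pow_mul, mul_comm N 2, pow_mul, hcosh,
    Real.artanh_eq_half_log ⟨by linarith, ht1.le⟩,
    Real.log_div h2.ne' h1.ne', Real.rpow_def_of_pos (by positivity),
    Real.rpow_def_of_pos (by positivity), Real.log_inv, Real.log_inv, ← Real.exp_add,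
    ← Real.exp_nat_mul, ← Real.exp_nat_mul, ← Real.exp_add, hyt]
  congr 1
  push_cast
  ring

/-- Extracting `exp (l N)` from the cosine power exposes the limit `l → ∞`, needed when `y ≥ N`. -/
theorem exp_mul_cosh_pow (y l : ℝ) :
    Real.exp (-l * y) * Real.cosh l ^ N =
      Real.exp (-l * (y - N)) * ((1 + Real.exp (-(2 * l))) / 2) ^ N := by
  have h : Real.cosh l = Real.exp l * ((1 + Real.exp (-(2 * l))) / 2) := by
    rw [Real.cosh_eq, mul_div_assoc', mul_add, ← Real.exp_add]
    ring_nf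
  rw [h, mul_pow, ← Real.exp_nat_mul, ← mul_assoc, ← Real.exp_add]
  ring_nf

/-- The function `tailBound` dominates the infimum over `l` of the Chernoff bounds. -/
theorem le_tailBound (hN : 0 < N) {y p : ℝ} (hy : 0 ≤ y)
    (hp : ∀ l, 0 ≤ l → p ≤ Real.exp (-l * y) * Real.cosh l ^ N) : p ≤ tailBound N y := by
  have hN' : (0 : ℝ) < N := Nat.cast_pos.2 hN
  have hlim : Filter.Tendsto (fun l : ℝ => ((1 + Real.exp (-(2 * l))) / 2) ^ N) Filter.atTop
      (nhds ((1 / 2) ^ N)) := by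
    have h : Filter.Tendsto (fun l : ℝ => Real.exp (-(2 * l))) Filter.atTop (nhds 0) :=
      Real.tendsto_exp_neg_atTop_nhds_zero.comp
        (Filter.tendsto_id.const_mul_atTop (by norm_num : (0 : ℝ) < 2))
    simpa using (((h.const_add 1).div_const 2).pow N)
  have hev : ∀ᶠ l : ℝ in Filter.atTop,
      p ≤ Real.exp (-l * (y - N)) * ((1 + Real.exp (-(2 * l))) / 2) ^ N := by
    filter_upwards [Filter.eventually_ge_atTop 0] with l hl
    rw [← exp_mul_cosh_pow]
    exact hp l hl
  -- For `y < N` the optimal `l` is finite. For `y ≥ N` the bound is the limit `l → ∞`: `2⁻ᴺ` at `y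
  -- = N`, and `0` beyond.
  rcases lt_trichotomy y N with hyN | rfl | hyN
  · rw [← exp_mul_cosh_artanh_pow_eq_tailBound hy hyN]
    exact hp _ (Real.artanh_nonneg (by positivity))
  · have h : tailBound N N = (1 / 2) ^ N := by
      rw [tailBound, if_pos le_rfl, sub_self, Real.rpow_zero, mul_one,
        Real.sqrt_eq_iff_eq_sq (by positivity) (by positivity), ← two_mul,
        show (N : ℝ) / (2 * N) = 1 / 2 by field_simp, ← pow_mul, mul_comm N 2]
      exact_mod_cast Real.rpow_natCast (1 / 2) (2 * N)
    rw [h]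
    refine ge_of_tendsto hlim (hev.mono fun l hl => ?_)
    simpa using hl
  · rw [tailBound, if_neg hyN.not_ge]
    have h : Filter.Tendsto (fun l : ℝ => Real.exp (-l * (y - N))) Filter.atTop (nhds 0) := by
      simpa [Function.comp_def] using Real.tendsto_exp_neg_atTop_nhds_zero.comp
        (Filter.tendsto_id.atTop_mul_const (sub_pos.2 hyN))
    simpa using ge_of_tendsto (h.mul hlim) hev

theorem tailBoundInv_nonneg (p : ℝ) : 0 ≤ tailBoundInv N p :=
  Real.sInf_nonneg fun _ hx => hx.1

end TailBound

/-- The sequence `d 0, …, d (N - 1)` of random variables, where `d j` is known at time `j + 1`, is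
a sequence of martingale differences with absolute values at most `c`. -/
structure IsBoundedMartingaleDifference {Ω : Type*} {mΩ : MeasurableSpace Ω} {N : ℕ}
    (ℱ : Filtration ℕ mΩ) (P : Measure Ω) (d : Fin N → Ω → ℝ) (c : ℝ) : Prop where
  stronglyMeasurable : ∀ j : Fin N, StronglyMeasurable[ℱ (j + 1)] (d j)
  abs_le : ∀ j, ∀ᵐ ω ∂P, |d j ω| ≤ c
  condExp_eq_zero : ∀ j : Fin N, P[d j | ℱ j] =ᵐ[P] 0

/-! ### Hoeffding's inequality and its maximal version -/

namespace IsBoundedMartingaleDifference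

variable {Ω : Type*} {mΩ : MeasurableSpace Ω} {N : ℕ} {ℱ : Filtration ℕ mΩ} {P : Measure Ω}
  {d : Fin N → Ω → ℝ} {c : ℝ}

theorem ae_abs_le (h : IsBoundedMartingaleDifference ℱ P d c) : ∀ᵐ ω ∂P, ∀ j, |d j ω| ≤ c :=
  ae_all_iff.2 h.abs_le

theorem stronglyMeasurable_partialSum (h : IsBoundedMartingaleDifference ℱ P d c) (n : ℕ) :
    StronglyMeasurable[ℱ n] fun ω => partialSum (fun j => d j ω) n :=
  _root_.stronglyMeasurable_partialSum fun j hj =>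
    (h.stronglyMeasurable j).mono (ℱ.mono (Nat.succ_le_of_lt hj))

theorem ae_abs_partialSum_le (h : IsBoundedMartingaleDifference ℱ P d c) (n : ℕ) :
    ∀ᵐ ω ∂P, |partialSum (fun j => d j ω) n| ≤ N * |c| := by
  filter_upwards [h.ae_abs_le] with ω hω
  refine (Finset.abs_sum_le_sum_abs _ _).trans
    ((Finset.sum_le_card_nsmul _ _ |c| fun j _ => (hω j).trans (le_abs_self c)).trans ?_)
  rw [nsmul_eq_mul]
  refine mul_le_mul_of_nonneg_right ?_ (abs_nonneg c)
  exact_mod_cast (Finset.card_le_univ _).trans_eq (Fintype.card_fin N)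

variable [IsProbabilityMeasure P]

theorem integrable (h : IsBoundedMartingaleDifference ℱ P d c) (j : Fin N) :
    Integrable (d j) P :=
  Integrable.of_bound ((h.stronglyMeasurable j).mono (ℱ.le _)).aestronglyMeasurable c
    (h.abs_le j)

/-- Predictable weights come out of the conditional expectation. With indicator weights this stops
or starts the martingale. -/
theorem mul (h : IsBoundedMartingaleDifference ℱ P d c) {w : Fin N → Ω → ℝ}
    (hw : ∀ j : Fin N, StronglyMeasurable[ℱ j] (w j)) {b : ℝ} (hwb : ∀ j ω, |w j ω| ≤ b) :
    IsBoundedMartingaleDifference ℱ P (fun j ω => w j ω * d j ω) (b * c) where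
  stronglyMeasurable j := ((hw j).mono (ℱ.mono (Nat.le_succ _))).mul (h.stronglyMeasurable j)
  abs_le j := by
    filter_upwards [h.abs_le j] with ω hω
    rw [abs_mul]
    exact mul_le_mul (hwb j ω) hω (abs_nonneg _) ((abs_nonneg _).trans (hwb j ω))
  condExp_eq_zero j := by
    have hint : Integrable (w j * d j) P := (h.integrable j).bdd_mul
      ((hw j).mono (ℱ.le _)).aestronglyMeasurable (ae_of_all _ (hwb j))
    filter_upwards [condExp_mul_of_stronglyMeasurable_left (hw j) hint (h.integrable j),
      h.condExp_eq_zero j] with ω h1 h2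
    exact h1.trans (by rw [Pi.mul_apply, h2, Pi.zero_apply, mul_zero])

theorem const_mul (h : IsBoundedMartingaleDifference ℱ P d c) (b : ℝ) :
    IsBoundedMartingaleDifference ℱ P (fun j ω => b * d j ω) (|b| * c) :=
  h.mul (w := fun _ _ => b) (fun _ => stronglyMeasurable_const) fun _ _ => le_rfl

theorem neg (h : IsBoundedMartingaleDifference ℱ P d c) :
    IsBoundedMartingaleDifference ℱ P (fun j ω => -d j ω) c := by
  simpa using h.const_mul (-1)

theorem integrable_exp (h : IsBoundedMartingaleDifference ℱ P d c) (l : ℝ) (n : ℕ) :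
    Integrable (fun ω => Real.exp (l * partialSum (fun j => d j ω) n)) P := by
  refine Integrable.of_bound (C := Real.exp (|l| * (N * |c|)))
    (((h.stronglyMeasurable_partialSum n).mono (ℱ.le n)).measurable.const_mul
      l).exp.aestronglyMeasurable ?_
  filter_upwards [h.ae_abs_partialSum_le n] with ω hω
  rw [Real.norm_eq_abs, Real.abs_exp]
  refine Real.exp_le_exp.2 ((le_abs_self _).trans ?_)
  rw [abs_mul]
  exact mul_le_mul_of_nonneg_left hω (abs_nonneg l)

/-- If the differences are at most `1`, the moment generating function is at most that of a sum of
independent signs. -/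
theorem integral_exp_partialSum_le (h : IsBoundedMartingaleDifference ℱ P d 1) (l : ℝ) {n : ℕ}
    (hn : n ≤ N) :
    ∫ ω, Real.exp (l * partialSum (fun j => d j ω) n) ∂P ≤ Real.cosh l ^ n := by
  induction n with
  | zero => simp
  | succ n ih =>
    have hlt : n < N := hn
    set Z : Ω → ℝ := fun ω => Real.exp (l * partialSum (fun j => d j ω) n) with hZ
    have hZint : Integrable Z P := h.integrable_exp l n
    have hZm : StronglyMeasurable[ℱ n] Z :=
      Real.continuous_exp.comp_stronglyMeasurable
        ((h.stronglyMeasurable_partialSum n).const_mul l)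
    have hZd : Integrable (Z * d ⟨n, hlt⟩) P := by
      have h1 : Integrable (d ⟨n, hlt⟩ * Z) P :=
        hZint.bdd_mul ((h.stronglyMeasurable ⟨n, hlt⟩).mono (ℱ.le _)).aestronglyMeasurable
          (h.abs_le ⟨n, hlt⟩)
      rwa [mul_comm] at h1
    have hzero : ∫ ω, Z ω * d ⟨n, hlt⟩ ω ∂P = 0 := by
      have h1 := integral_condExp (μ := P) (f := Z * d ⟨n, hlt⟩) (ℱ.le n)
      refine (h1.symm.trans (integral_eq_zero_of_ae ?_))
      filter_upwards [condExp_mul_of_stronglyMeasurable_left hZm hZd (h.integrable ⟨n, hlt⟩),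
        h.condExp_eq_zero ⟨n, hlt⟩] with ω h1 h2
      exact h1.trans (by rw [Pi.mul_apply, h2, Pi.zero_apply, mul_zero])
    calc ∫ ω, Real.exp (l * partialSum (fun j => d j ω) (n + 1)) ∂P
        ≤ ∫ ω, (Real.cosh l * Z ω + Real.sinh l * (Z ω * d ⟨n, hlt⟩ ω)) ∂P := by
          refine integral_mono_ae (h.integrable_exp l (n + 1))
            ((hZint.const_mul _).add (hZd.const_mul _)) ?_
          filter_upwards [h.abs_le ⟨n, hlt⟩] with ω hω
          -- On `[-1, 1]` the convex exponential lies below its chord; the linear term integrates to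
          -- zero by `hzero`.
          have h1 := Real.exp_mul_le_cosh_add_mul_sinh hω l
          simp only [partialSum_succ _ hlt, mul_add, Real.exp_add]
          refine (mul_le_mul_of_nonneg_left
            ((congrArg Real.exp (mul_comm _ _)).trans_le h1) (Real.exp_pos _).le).trans_eq ?_
          rw [hZ]
          ring
      _ = Real.cosh l * ∫ ω, Z ω ∂P := by
          have hZd' : Integrable (fun ω => Z ω * d ⟨n, hlt⟩ ω) P := hZd
          rw [integral_add (hZint.const_mul _) (hZd'.const_mul _), integral_const_mul,
            integral_const_mul, hzero, mul_zero, add_zero]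
      _ ≤ Real.cosh l ^ (n + 1) := by
          rw [pow_succ']
          exact mul_le_mul_of_nonneg_left (ih hlt.le) (Real.cosh_pos l).le

theorem measure_le_partialSum_le (h : IsBoundedMartingaleDifference ℱ P d c) (hN : 0 < N)
    (hc : 0 < c) {y : ℝ} (hy : 0 ≤ y) :
    P {ω | c * y ≤ partialSum (fun j => d j ω) N} ≤ ENNReal.ofReal (tailBound N y) := by
  have h' : IsBoundedMartingaleDifference ℱ P (fun j ω => c⁻¹ * d j ω) 1 := by
    simpa [abs_of_pos, hc, hc.ne'] using h.const_mul c⁻¹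
  have hset : {ω | c * y ≤ partialSum (fun j => d j ω) N} =
      {ω | y ≤ partialSum (fun j => c⁻¹ * d j ω) N} := by
    ext ω
    rw [Set.mem_ofPred_eq, Set.mem_ofPred_eq, partialSum_const_mul, inv_mul_eq_div,
      le_div_iff₀' hc]
  rw [hset, ← ofReal_measureReal]
  refine ENNReal.ofReal_le_ofReal (le_tailBound hN hy fun l hl => ?_)
  refine (measure_ge_le_exp_mul_mgf y hl (h'.integrable_exp l N)).trans ?_
  exact mul_le_mul_of_nonneg_left (h'.integral_exp_partialSum_le l le_rfl) (Real.exp_pos _).le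

/-- The infimum defining `tailBoundInv` is approached from within its set; continuity of the measure
along increasing events passes to the limit, so attainment is not needed. -/
theorem measure_lt_partialSum_le (h : IsBoundedMartingaleDifference ℱ P d c) (hN : 0 < N)
    (hc : 0 ≤ c) {p : ℝ} (hp : 0 ≤ p) :
    P {ω | c * tailBoundInv N p < partialSum (fun j => d j ω) N} ≤ ENNReal.ofReal p := by
  rcases hc.eq_or_lt with rfl | hc
  · refine (measure_eq_zero_iff_ae_notMem.2 ?_).trans_le zero_le
    filter_upwards [h.ae_abs_partialSum_le N] with ω hω
    rw [abs_zero, mul_zero] at hω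
    rw [zero_mul, not_lt]
    exact (le_abs_self _).trans hω
  · have hne : {x : ℝ | 0 ≤ x ∧ tailBound N x ≤ p}.Nonempty := by
      refine ⟨N + 1, by positivity, ?_⟩
      rwa [tailBound, if_neg (by simp)]
    obtain ⟨u, hu, hlim, hmem⟩ := exists_seq_tendsto_sInf hne ⟨0, fun x hx => hx.1⟩
    have hmono : Monotone fun n => {ω | c * u n ≤ partialSum (fun j => d j ω) N} :=
      fun m n hmn ω hω => (mul_le_mul_of_nonneg_left (hu hmn) hc.le).trans hω
    refine (measure_mono fun ω hω => ?_).trans (le_of_tendsto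
      (tendsto_measure_iUnion_atTop (μ := P) hmono) (Filter.Eventually.of_forall fun n => ?_))
    · obtain ⟨n, hn⟩ := ((hlim.const_mul c).eventually_lt_const hω).exists
      exact Set.mem_iUnion.2 ⟨n, hn.le⟩
    · exact (h.measure_le_partialSum_le hN hc (hmem n).1).trans
        (ENNReal.ofReal_le_ofReal (hmem n).2)

/-- Freezing the martingale at its first passage above the threshold keeps its final value above it,
so the bound at time `N` already covers the maximum. -/
theorem measure_exists_lt_partialSum_le (h : IsBoundedMartingaleDifference ℱ P d c) (hN : 0 < N)
    (hc : 0 ≤ c) {p : ℝ} (hp : 0 ≤ p) :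
    P {ω | ∃ n ≤ N, c * tailBoundInv N p < partialSum (fun j => d j ω) n} ≤
      ENNReal.ofReal p := by
  classical
  set C := c * tailBoundInv N p with hC
  -- The event that no passage has occurred up to time `j`, so its indicator is a predictable
  -- weight.
  set s : Fin N → Set Ω := fun j => {ω | ∀ i ≤ (j : ℕ), partialSum (fun j => d j ω) i ≤ C} with hs
  have hsm : ∀ j : Fin N, MeasurableSet[ℱ j] (s j) := by
    intro j
    have h1 : s j = ⋂ i, ⋂ (_ : i ≤ (j : ℕ)), {ω | partialSum (fun j => d j ω) i ≤ C} := by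
      ext ω
      simp [hs]
    rw [h1]
    exact MeasurableSet.iInter fun i => MeasurableSet.iInter fun hi =>
      ((h.stronglyMeasurable_partialSum i).mono (ℱ.mono hi)).measurableSet_le
        stronglyMeasurable_const
  have h' := h.mul (w := fun j => (s j).indicator 1) (b := 1)
    (fun j => (stronglyMeasurable_one.indicator (hsm j))) fun j ω => by
      by_cases hω : ω ∈ s j <;> simp [hω]
  rw [one_mul] at h'
  refine (measure_mono fun ω hω => ?_).trans (h'.measure_lt_partialSum_le hN hc hp)
  have hex : ∃ n, n ≤ N ∧ C < partialSum (fun j => d j ω) n := hω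
  have hfind := Nat.find_spec hex
  have hw : ∀ j : Fin N, (s j).indicator (1 : Ω → ℝ) ω =
      if (j : ℕ) < Nat.find hex then 1 else 0 := by
    intro j
    rw [Set.indicator_apply]
    refine if_congr ⟨fun hj => ?_, fun hj i hi => ?_⟩ rfl rfl
    · by_contra hlt
      exact (hj _ (not_lt.1 hlt)).not_gt hfind.2
    · have h1 := Nat.find_min hex (hi.trans_lt hj)
      exact not_lt.1 fun h2 => h1 ⟨hi.trans j.2.le, h2⟩
  simp only [Set.mem_ofPred_eq, hw]
  rw [partialSum_ite_lt]
  exact hfind.2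

end IsBoundedMartingaleDifference

/-! ### Pathwise bounds and the stopping rule -/

section Deterministic

variable {N : ℕ}

theorem partialSum_le_add {f : Fin N → ℝ} {M : ℝ} {n p : ℕ} (hnp : n ≤ p) (hp : p ≤ N)
    (hf : ∀ j : Fin N, n ≤ (j : ℕ) → f j ≤ M) :
    partialSum f p ≤ partialSum f n + ((p : ℝ) - n) * M := by
  induction p, hnp using Nat.le_induction with
  | base => simp
  | succ p hnp ih =>
    have h1 := ih (by omega)
    have h2 := hf ⟨p, hp⟩ hnp
    rw [partialSum_succ f hp]
    push_cast
    linarith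

theorem add_le_partialSum {f : Fin N → ℝ} {M : ℝ} {n p : ℕ} (hnp : n ≤ p) (hp : p ≤ N)
    (hf : ∀ j : Fin N, n ≤ (j : ℕ) → (j : ℕ) < p → M ≤ f j) :
    partialSum f n + ((p : ℝ) - n) * M ≤ partialSum f p := by
  induction p, hnp using Nat.le_induction with
  | base => simp
  | succ p hnp ih =>
    have h1 := ih (by omega) fun j hj hjp => hf j hj (by omega)
    have h2 := hf ⟨p, hp⟩ hnp (Nat.lt_succ_self p)
    rw [partialSum_succ f hp]
    push_cast
    linarith

theorem lowerBound_le_partialSum {a : ℝ} {f : Fin N → ℝ} (hf : ∀ j, a ≤ f j) {n : ℕ}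
    (hn : n ≤ N) : lowerBound a f n ≤ partialSum f N :=
  add_le_partialSum hn le_rfl fun j _ _ => hf j

/-- If the conditional means `m j` decrease and the centered partial sums stay within the slack,
then the upper bound holds. -/
theorem partialSum_le_upperBound {a b δ : ℝ} {f m : Fin N → ℝ} (hf : ∀ j, f j ≤ b)
    (hm : Antitone m) {n : ℕ} (hn : 1 ≤ n) (hnN : n ≤ N)
    (h1 : -partialSum (fun j => f j - m j) n ≤ slack N a b δ)
    (h2 : partialSum (fun j => f j - m j) N - partialSum (fun j => f j - m j) n ≤
      slack N a b δ) : partialSum f N ≤ upperBound a b δ f n := by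
  have hfb := partialSum_le_add hnN le_rfl fun j _ => hf j
  rw [partialSum_sub] at h1
  rw [partialSum_sub, partialSum_sub] at h2
  -- The last observed index: `m l` is below every earlier mean and above every later one.
  set l : Fin N := ⟨n - 1, by omega⟩ with hl
  have hhigh : partialSum m N ≤ partialSum m n + ((N : ℝ) - n) * m l :=
    partialSum_le_add hnN le_rfl fun j hj => hm (Fin.le_def.2 (by simp [hl]; omega))
  have hlow : partialSum m 0 + ((n : ℝ) - (0 : ℕ)) * m l ≤ partialSum m n :=
    add_le_partialSum (Nat.zero_le n) hnN fun j _ hj => hm (Fin.le_def.2 (by simp [hl]; omega))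
  have hn0 : (0 : ℝ) < n := by exact_mod_cast hn
  have hml : m l ≤ (partialSum f n + slack N a b δ) / n := by
    rw [le_div_iff₀ hn0]
    rw [partialSum_zero] at hlow
    push_cast at hlow
    linarith
  have hNn : (0 : ℝ) ≤ (N : ℝ) - n := sub_nonneg.2 (Nat.cast_le.2 hnN)
  have h3 := mul_le_mul_of_nonneg_left hml hNn
  rw [upperBound, ← sub_le_iff_le_add']
  exact le_min (by linarith) (by linarith)

theorem sign_eq_sign_and_ne_zero_iff (x y : ℝ) :
    SignType.sign x = SignType.sign y ∧ SignType.sign y ≠ 0 ↔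
      0 < x ∧ 0 < y ∨ x < 0 ∧ y < 0 := by
  rcases lt_trichotomy x 0 with hx | rfl | hx <;> rcases lt_trichotomy y 0 with hy | rfl | hy <;>
    simp [*, sign_pos, sign_neg, not_lt_of_gt]

/-- A midpoint errs by at most half the width, which the rule bounds by `r * min |U| |L|`. Equal
nonzero signs make this minimum positive and at most `|D|`. -/
theorem abs_sub_estimator_le {a b δ r : ℝ} {f : Fin N → ℝ} {n : ℕ}
    (hcond : StopCondition a b δ r f n) {D : ℝ} (hl : lowerBound a f n ≤ D)
    (hu : D ≤ upperBound a b δ f n) (hr : 0 ≤ r) : |D - estimator a b δ f n| ≤ r * |D| := by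
  obtain ⟨hsign, hprec⟩ := hcond
  rw [estimator]
  set L := lowerBound a f n
  set U := upperBound a b δ f n
  have hhalf : |D - (L + U) / 2| ≤ (U - L) / 2 := abs_le.2 ⟨by linarith, by linarith⟩
  rw [sign_eq_sign_and_ne_zero_iff] at hsign
  have hmin : 0 < min |U| |L| ∧ min |U| |L| ≤ |D| := by
    rcases hsign with ⟨hU, hL⟩ | ⟨hU, hL⟩
    · refine ⟨lt_min (abs_pos.2 hU.ne') (abs_pos.2 hL.ne'), (min_le_right _ _).trans ?_⟩
      rw [abs_of_pos hL, abs_of_pos (hL.trans_le hl)]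
      exact hl
    · refine ⟨lt_min (abs_pos.2 hU.ne) (abs_pos.2 hL.ne), (min_le_left _ _).trans ?_⟩
      rw [abs_of_neg hU, abs_of_neg (hu.trans_lt hU)]
      exact neg_le_neg hu
  rw [div_le_iff₀ (by linarith [hmin.1])] at hprec
  have := mul_le_mul_of_nonneg_left hmin.2 hr
  linarith

theorem slack_nonneg {a b : ℝ} (hab : a ≤ b) (δ : ℝ) : 0 ≤ slack N a b δ :=
  mul_nonneg (sub_nonneg.2 hab) (tailBoundInv_nonneg _)

/-- With no summand left, the nonnegative slack makes the minimum in `upperBound` zero, so running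
to the end is exact. -/
theorem estimator_self {a b δ : ℝ} (hab : a ≤ b) (f : Fin N → ℝ) :
    estimator a b δ f N = partialSum f N := by
  simp [estimator, lowerBound, upperBound, slack_nonneg hab]

theorem stoppingStep_mem (a b δ r : ℝ) (f : Fin N → ℝ) :
    stoppingStep a b δ r f = N ∨ 1 ≤ stoppingStep a b δ r f ∧ stoppingStep a b δ r f < N ∧
      StopCondition a b δ r f (stoppingStep a b δ r f) :=
  Nat.sInf_mem (s := {n : ℕ | n = N ∨ (1 ≤ n ∧ n < N ∧ StopCondition a b δ r f n)})
    ⟨N, Or.inl rfl⟩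

theorem stoppingStep_le (a b δ r : ℝ) (f : Fin N → ℝ) : stoppingStep a b δ r f ≤ N :=
  Nat.sInf_le (Or.inl rfl)

theorem one_le_stoppingStep (hN : 1 ≤ N) (a b δ r : ℝ) (f : Fin N → ℝ) :
    1 ≤ stoppingStep a b δ r f := by
  rcases stoppingStep_mem a b δ r f with h | h
  · rwa [h]
  · exact h.1

theorem stoppingStep_le_iff (a b δ r : ℝ) (f : Fin N → ℝ) (n : ℕ) :
    stoppingStep a b δ r f ≤ n ↔
      ∃ i ≤ n, i = N ∨ (1 ≤ i ∧ i < N ∧ StopCondition a b δ r f i) :=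
  ⟨fun h => ⟨_, h, stoppingStep_mem a b δ r f⟩, fun ⟨_, hi, hmem⟩ => (Nat.sInf_le hmem).trans hi⟩

theorem abs_sub_estimator_stoppingStep_le {a b δ r : ℝ} {f : Fin N → ℝ} (hab : a ≤ b)
    (hf : ∀ j, a ≤ f j) (hr : 0 ≤ r)
    (hu : partialSum f N ≤ upperBound a b δ f (stoppingStep a b δ r f)) :
    |partialSum f N - estimator a b δ f (stoppingStep a b δ r f)| ≤ r * |partialSum f N| := by
  rcases stoppingStep_mem a b δ r f with h | ⟨-, hlt, hcond⟩
  · rw [h, estimator_self hab, sub_self, abs_zero]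
    positivity
  · exact abs_sub_estimator_le hcond (lowerBound_le_partialSum hf hlt.le) hu hr

end Deterministic

/-! ### The upper bound at a stopping time -/

section Stochastic

variable {Ω : Type*} {N : ℕ}

theorem measurableSet_stopCondition {m : MeasurableSpace Ω} {f : Fin N → Ω → ℝ} {n : ℕ}
    (hf : ∀ j : Fin N, (j : ℕ) < n → StronglyMeasurable[m] (f j)) (a b δ r : ℝ) :
    MeasurableSet[m] {ω | StopCondition a b δ r (fun j => f j ω) n} := by
  have hD := (stronglyMeasurable_partialSum hf).measurable
  have hL : Measurable[m] fun ω => lowerBound a (fun j => f j ω) n := hD.add_const _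
  have hU : Measurable[m] fun ω => upperBound a b δ (fun j => f j ω) n :=
    hD.add (((((hD.add_const _).div_const _).const_mul _).const_add _).min measurable_const)
  simp only [StopCondition, sign_eq_sign_and_ne_zero_iff]
  refine MeasurableSet.inter (MeasurableSet.union
    ((measurableSet_lt measurable_const hU).inter (measurableSet_lt measurable_const hL))
    ((measurableSet_lt hU measurable_const).inter (measurableSet_lt hL measurable_const)))
    (measurableSet_le ((hU.sub hL).div ((Measurable.min ?_ ?_).const_mul 2)) measurable_const)
  · exact continuous_abs.measurable.comp hU
  · exact continuous_abs.measurable.comp hL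

theorem measurableSet_stoppingStep_le {mΩ : MeasurableSpace Ω} {ℱ : Filtration ℕ mΩ}
    {f : Fin N → Ω → ℝ} (hf : ∀ j : Fin N, StronglyMeasurable[ℱ (j + 1)] (f j))
    (a b δ r : ℝ) (n : ℕ) :
    MeasurableSet[ℱ n] {ω | stoppingStep a b δ r (fun j => f j ω) ≤ n} := by
  have h : {ω | stoppingStep a b δ r (fun j => f j ω) ≤ n} = ⋃ i, ⋃ (_ : i ≤ n),
      {ω | i = N ∨ (1 ≤ i ∧ i < N ∧ StopCondition a b δ r (fun j => f j ω) i)} := by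
    ext ω
    simp [stoppingStep_le_iff]
  rw [h]
  refine MeasurableSet.iUnion fun i => MeasurableSet.iUnion fun hi => ?_
  refine (MeasurableSet.const _).union ((MeasurableSet.const _).inter
    ((MeasurableSet.const _).inter (measurableSet_stopCondition (fun j hj => ?_) a b δ r)))
  exact (hf j).mono (ℱ.mono (by omega))

variable {mΩ : MeasurableSpace Ω} {ℱ : Filtration ℕ mΩ} {P : Measure Ω} [IsProbabilityMeasure P]
  {f : Fin N → Ω → ℝ} {a b : ℝ}

/-- The conditional mean lies in `[a, b]` too, so the difference is at most `b - a` in absolute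
value. -/
theorem isBoundedMartingaleDifference_sub_condExp
    (hf : ∀ j : Fin N, StronglyMeasurable[ℱ (j + 1)] (f j))
    (hfab : ∀ j, ∀ᵐ ω ∂P, f j ω ∈ Set.Icc a b) :
    IsBoundedMartingaleDifference ℱ P (fun j ω => f j ω - P[f j | ℱ j] ω) (b - a) := by
  have hint : ∀ j, Integrable (f j) P := fun j =>
    Integrable.of_mem_Icc a b ((hf j).mono (ℱ.le _)).measurable.aemeasurable (hfab j)
  refine ⟨fun j => (hf j).sub (stronglyMeasurable_condExp.mono (ℱ.mono (Nat.le_succ _))),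
    fun j => ?_, fun j => ?_⟩
  · have h1 : ∀ᵐ ω ∂P, a ≤ P[f j | ℱ j] ω := by
      have h := condExp_mono (m := ℱ j) (integrable_const a) (hint j)
        ((hfab j).mono fun ω hω => hω.1)
      rwa [condExp_const (ℱ.le _)] at h
    have h2 : ∀ᵐ ω ∂P, P[f j | ℱ j] ω ≤ b := by
      have h := condExp_mono (m := ℱ j) (hint j) (integrable_const b)
        ((hfab j).mono fun ω hω => hω.2)
      rwa [condExp_const (ℱ.le _)] at h
    filter_upwards [h1, h2, hfab j] with ω h1 h2 h3
    exact abs_le.2 ⟨by linarith [h3.1], by linarith [h3.2]⟩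
  · have h1 := condExp_sub (hint j) (integrable_condExp (μ := P) (m := ℱ j) (f := f j)) (ℱ j)
    rw [condExp_of_stronglyMeasurable (ℱ.le j) stronglyMeasurable_condExp integrable_condExp,
      sub_self] at h1
    exact h1

/-- If the conditional means decrease, the upper bound at a stopping time holds up to probability
`δ`. -/
theorem measure_upperBound_lt_partialSum_le (hN : 1 ≤ N) (hab : a ≤ b)
    (hf : ∀ j : Fin N, StronglyMeasurable[ℱ (j + 1)] (f j))
    (hfab : ∀ j, ∀ᵐ ω ∂P, f j ω ∈ Set.Icc a b)
    (hanti : ∀ i j : Fin N, i ≤ j → P[f j | ℱ j] ≤ᵐ[P] P[f i | ℱ i])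
    {τ : Ω → ℕ} (hτ : ∀ n, MeasurableSet[ℱ n] {ω | τ ω ≤ n}) (hτ1 : ∀ ω, 1 ≤ τ ω)
    (hτN : ∀ ω, τ ω ≤ N) {δ : ℝ} (hδ : 0 ≤ δ) :
    P {ω | upperBound a b δ (fun j => f j ω) (τ ω) < partialSum (fun j => f j ω) N} ≤
      ENNReal.ofReal δ := by
  have hd := isBoundedMartingaleDifference_sub_condExp hf hfab
  set d : Fin N → Ω → ℝ := fun j ω => f j ω - P[f j | ℱ j] ω with hddef
  -- These weights start the martingale at `τ`: the weighted sum is `M_N - M_τ`. Index `j` is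
  -- revealed at time `j + 1`, so `{τ ≤ j}` is predictable.
  set w : Fin N → Ω → ℝ := fun j => {ω | τ ω ≤ j}.indicator 1 with hw
  have hwd := hd.mul (w := w) (b := 1) (fun j => stronglyMeasurable_one.indicator (hτ j))
    fun j ω => by by_cases hω : τ ω ≤ j <;> simp [hw, hω]
  rw [one_mul] at hwd
  -- Control at every `n` simultaneously allows evaluation at the random step `τ`.
  have hE1 := hd.neg.measure_exists_lt_partialSum_le hN
    (sub_nonneg.2 hab) (div_nonneg hδ zero_le_two)
  have hE2 := hwd.measure_lt_partialSum_le hN (sub_nonneg.2 hab) (div_nonneg hδ zero_le_two)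
  have hE3 : P {ω | ¬ ((∀ j, f j ω ≤ b) ∧ Antitone fun j : Fin N => P[f j | ℱ j] ω)} = 0 := by
    refine ae_iff.1 ?_
    have h1 : ∀ᵐ ω ∂P, ∀ i j : Fin N, i ≤ j → P[f j | ℱ j] ω ≤ P[f i | ℱ i] ω := by
      simp only [ae_all_iff]
      exact hanti
    filter_upwards [ae_all_iff.2 hfab, h1] with ω h1 h2
    exact ⟨fun j => (h1 j).2, fun i j hij => h2 i j hij⟩
  refine (measure_mono (t := _ ∪ (_ ∪ _)) fun ω hω => ?_).trans
    ((measure_union_le _ _).trans ((add_le_add hE3.le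
      ((measure_union_le _ _).trans (add_le_add hE1 hE2))).trans_eq ?_))
  · by_contra hnot
    obtain ⟨h0, h12⟩ := not_or.1 hnot
    obtain ⟨h1, h2⟩ := not_or.1 h12
    obtain ⟨hfb, hm⟩ := not_not.1 h0
    simp only [Set.mem_ofPred_eq, not_exists, not_and, not_lt] at h1 h2
    have hws : ∀ j : Fin N, w j ω = if τ ω ≤ j then 1 else 0 := fun j => by
      simp [hw, Set.indicator_apply]
    simp only [hws] at h2
    rw [partialSum_ite_ge] at h2
    have h1' := h1 (τ ω) (hτN ω)
    rw [partialSum_neg] at h1'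
    exact (partialSum_le_upperBound hfb hm (hτ1 ω) (hτN ω) h1' h2).not_gt hω
  · rw [zero_add, ← ENNReal.ofReal_add (by positivity) (by positivity), add_halves]

end Stochastic

/-! ### Conditional expectation under independence -/

/-- Independence makes the joint law a product; Fubini then verifies the defining identity on each
set `Y ⁻¹' t`. -/
theorem condExp_comap_comp_of_indepFun {Ω Ω' 𝕏 : Type*} [MeasurableSpace Ω'] [MeasurableSpace 𝕏]
    {mΩ : MeasurableSpace Ω} {P : Measure Ω} [IsProbabilityMeasure P] {Y : Ω → Ω'} {X : Ω → 𝕏}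
    (hY : Measurable Y) (hX : Measurable X) (hYX : IndepFun Y X P) {φ : Ω' → 𝕏 → ℝ}
    (hφ : Measurable (Function.uncurry φ)) {C : ℝ}
    (hC : ∀ u, ∀ᵐ y ∂(P.map X), |φ u y| ≤ C) :
    P[fun ω => φ (Y ω) (X ω) | MeasurableSpace.comap Y inferInstance] =ᵐ[P]
      fun ω => ∫ y, φ (Y ω) y ∂(P.map X) := by
  have : IsProbabilityMeasure (P.map X) := Measure.isProbabilityMeasure_map hX.aemeasurable
  have : IsProbabilityMeasure (P.map Y) := Measure.isProbabilityMeasure_map hY.aemeasurable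
  have hlaw := (indepFun_iff_map_prod_eq_prod_map_map hY.aemeasurable hX.aemeasurable).1 hYX
  have hYX' : Measurable fun ω => (Y ω, X ω) := hY.prodMk hX
  have hint : Integrable (Function.uncurry φ) ((P.map Y).prod (P.map X)) := by
    refine Integrable.of_bound hφ.aestronglyMeasurable C ?_
    refine (Measure.ae_prod_iff_ae_ae (measurableSet_le hφ.norm measurable_const)).2
      (ae_of_all _ hC)
  have hg : StronglyMeasurable fun u => ∫ y, φ u y ∂(P.map X) :=
    hφ.stronglyMeasurable.integral_prod_right
  have hgint : Integrable (fun ω => ∫ y, φ (Y ω) y ∂(P.map X)) P :=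
    hint.integral_prod_left.comp_measurable hY
  refine (ae_eq_condExp_of_forall_setIntegral_eq hY.comap_le ?_ (fun _ _ _ => hgint.integrableOn)
    ?_ (hg.comp_measurable (comap_measurable Y)).aestronglyMeasurable).symm
  · rw [← hlaw] at hint
    exact hint.comp_measurable hYX'
  · rintro _ ⟨t, ht, rfl⟩ -
    have h1 := setIntegral_map (μ := P) (f := Function.uncurry φ) (ht.prod MeasurableSet.univ)
      hφ.aestronglyMeasurable hYX'.aemeasurable
    have h2 := setIntegral_map (μ := P) ht hg.aestronglyMeasurable hY.aemeasurable
    rw [← h2]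
    rw [hlaw, setIntegral_prod _ hint.integrableOn] at h1
    simpa [Set.prod_univ, ← Set.preimage_comp, Function.comp_def] using h1

/-- The previous result with `Y` the identity from `Ω` to `Ω` carrying the smaller σ-algebra `m`. -/
theorem condExp_comp_of_indep {Ω 𝕏 : Type*} [MeasurableSpace 𝕏] {m mΩ : MeasurableSpace Ω}
    {P : Measure Ω} [IsProbabilityMeasure P] (hm : m ≤ mΩ) {X : Ω → 𝕏} (hX : Measurable X)
    (hindep : Indep m (MeasurableSpace.comap X inferInstance) P) {φ : Ω → 𝕏 → ℝ}
    (hφ : Measurable[m.prod inferInstance] (Function.uncurry φ)) {C : ℝ}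
    (hC : ∀ ω, ∀ᵐ y ∂(P.map X), |φ ω y| ≤ C) :
    P[fun ω => φ ω (X ω) | m] =ᵐ[P] fun ω => ∫ y, φ ω y ∂(P.map X) := by
  have hid : @IndepFun Ω Ω 𝕏 mΩ m _ id X P := by
    refine (@IndepFun_iff_Indep Ω Ω 𝕏 mΩ m _ id X P).2 ?_
    rwa [MeasurableSpace.comap_id]
  have h := @condExp_comap_comp_of_indepFun Ω Ω 𝕏 m _ mΩ P _ id X (measurable_id'' hm) hX hid φ hφ
    C hC
  rwa [MeasurableSpace.comap_id] at h

theorem logDetSummand_update_mem_Icc {𝕏 : Type*} {N : ℕ} {k : 𝕏 → 𝕏 → ℝ} {σ : ℝ}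
    (hk : (Matrix.of k).PosSemidef) (hσ : 0 < σ) {b : ℝ} {y : 𝕏}
    (hy : Real.log (k y y + σ ^ 2) ≤ b) (u : Fin N → 𝕏) (j : Fin N) :
    logDetSummand k σ (Function.update u j y) j ∈ Set.Icc (Real.log (σ ^ 2)) b := by
  refine ⟨le_logDetSummand hk hσ _ _, (logDetSummand_le hk hσ _ _).trans ?_⟩
  rwa [Function.update_self]

/-! ### Decreasing conditional means -/

section CanonicalFiltration

variable {Ω 𝕏 : Type*} [MeasurableSpace Ω] [MeasurableSpace 𝕏] {N : ℕ} {x : Fin N → Ω → 𝕏}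
  (hx : ∀ j, Measurable (x j))

theorem measurable_canonicalFiltration {j : Fin N} {n : ℕ} (hj : (j : ℕ) < n) :
    Measurable[canonicalFiltration x hx n] (x j) :=
  measurable_iff_comap_le.2
    (le_iSup₂_of_le (f := fun (j : Fin N) (_ : (j : ℕ) < n) =>
      MeasurableSpace.comap (x j) inferInstance) j hj le_rfl)

theorem indep_canonicalFiltration {P : Measure Ω} (hindep : iIndepFun x P) (j : Fin N) :
    Indep (canonicalFiltration x hx j) (MeasurableSpace.comap (x j) inferInstance) P := by
  have h := indep_iSup_of_disjoint (fun i => (hx i).comap_le)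
    ((iIndepFun_iff_iIndep _ _ _).1 hindep) (S := {i : Fin N | (i : ℕ) < j}) (T := {j})
    (by simp)
  rwa [iSup_singleton] at h

variable {k : 𝕏 → 𝕏 → ℝ} {σ : ℝ}

theorem stronglyMeasurable_logDetSummand (hk : (Matrix.of k).PosSemidef) (hσ : 0 < σ)
    (hk_meas : Measurable (Function.uncurry k)) (j : Fin N) :
    StronglyMeasurable[canonicalFiltration x hx (j + 1)]
      fun ω => logDetSummand k σ (fun i => x i ω) j :=
  Measurable.stronglyMeasurable <| @measurable_logDetSummand 𝕏 N k σ Ω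
    (canonicalFiltration x hx (j + 1)) _ hk hσ hk_meas (fun ω i => x i ω) j fun _ hi =>
      measurable_canonicalFiltration hx (Nat.lt_succ_of_le hi)

theorem measurable_logDetSummand_update (hk : (Matrix.of k).PosSemidef) (hσ : 0 < σ)
    (hk_meas : Measurable (Function.uncurry k)) (j : Fin N) :
    Measurable[(canonicalFiltration x hx j).prod inferInstance] (Function.uncurry fun ω y =>
      logDetSummand k σ (Function.update (fun i => x i ω) j y) j) := by
  refine @measurable_logDetSummand 𝕏 N k σ (Ω × 𝕏)
    ((canonicalFiltration x hx j).prod inferInstance) _ hk hσ hk_meas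
    (fun z => Function.update (fun i => x i z.1) j z.2) j fun i hi => ?_
  rcases hi.eq_or_lt with rfl | hlt
  · simp only [Function.update_self]
    exact @measurable_snd _ _ (canonicalFiltration x hx i) _
  · simp only [Function.update_of_ne hlt.ne]
    exact (measurable_canonicalFiltration hx hlt).comp
      (@measurable_fst _ _ (canonicalFiltration x hx j) _)

theorem condExp_logDetSummand {P : Measure Ω} [IsProbabilityMeasure P]
    (hk : (Matrix.of k).PosSemidef) (hσ : 0 < σ) (hk_meas : Measurable (Function.uncurry k))
    (hindep : iIndepFun x P) (j : Fin N) {b : ℝ}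
    (hb : ∀ᵐ y ∂(P.map (x j)), Real.log (k y y + σ ^ 2) ≤ b) :
    P[fun ω => logDetSummand k σ (fun i => x i ω) j | canonicalFiltration x hx j] =ᵐ[P]
      fun ω => ∫ y, logDetSummand k σ (Function.update (fun i => x i ω) j y) j ∂(P.map (x j)) := by
  have h := condExp_comp_of_indep ((canonicalFiltration x hx).le j) (hx j)
    (indep_canonicalFiltration hx hindep j) (measurable_logDetSummand_update hx hk hσ hk_meas j)
    (C := max |Real.log (σ ^ 2)| |b|) fun ω => hb.mono fun y hy => by
      have h1 := logDetSummand_update_mem_Icc hk hσ hy (fun i => x i ω) j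
      exact abs_le_max_abs_abs h1.1 h1.2
  have hup : ∀ ω, Function.update (fun i => x i ω) j (x j ω) = fun i => x i ω :=
    fun ω => Function.update_eq_self j _
  simpa only [hup] using h

/-- Freezing the past turns both conditional means into integrals of log-pivots over a fresh point
with the same law, where the integrands compare pointwise. -/
theorem condExp_logDetSummand_le {P : Measure Ω} [IsProbabilityMeasure P]
    (hk : (Matrix.of k).PosSemidef) (hσ : 0 < σ) (hk_meas : Measurable (Function.uncurry k))
    (hindep : iIndepFun x P) (hident : ∀ i j, IdentDistrib (x i) (x j) P P) {b : ℝ}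
    (hb : ∀ j, ∀ᵐ y ∂(P.map (x j)), Real.log (k y y + σ ^ 2) ≤ b) {i j : Fin N} (hij : i ≤ j) :
    P[fun ω => logDetSummand k σ (fun i => x i ω) j | canonicalFiltration x hx j] ≤ᵐ[P]
      P[fun ω => logDetSummand k σ (fun i => x i ω) i | canonicalFiltration x hx i] := by
  have : IsProbabilityMeasure (P.map (x i)) :=
    Measure.isProbabilityMeasure_map (hx i).aemeasurable
  have hint : ∀ (u : Fin N → 𝕏) (j : Fin N), Integrable
      (fun y => logDetSummand k σ (Function.update u j y) j) (P.map (x i)) := fun u j =>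
    Integrable.of_mem_Icc _ b (measurable_logDetSummand hk hσ hk_meas fun l _ =>
      (measurable_pi_apply l).comp (measurable_update u)).aemeasurable
      ((hb i).mono fun y hy => logDetSummand_update_mem_Icc hk hσ hy u j)
  filter_upwards [condExp_logDetSummand hx hk hσ hk_meas hindep j (hb j),
    condExp_logDetSummand hx hk hσ hk_meas hindep i (hb i)] with ω hj hi
  rw [hj, hi, (hident j i).map_eq]
  refine integral_mono (hint _ j) (hint _ i) fun y => ?_
  refine logDetSummand_le_logDetSummand hk hσ hij (fun l hl => ?_) ?_
  · rw [Function.update_of_ne (hl.trans_le hij).ne, Function.update_of_ne hl.ne]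
  · rw [Function.update_self, Function.update_self]

end CanonicalFiltration



/-- The relative error exceeds `r` when `|log det A - D̂| > r |log det A|`; written without a
quotient, this also counts the case `log det A = 0 ≠ D̂` as a failure. -/
theorem theorem2 {Ω 𝕏 : Type*} [MeasurableSpace Ω] [MeasurableSpace 𝕏]
    (P : Measure Ω) [IsProbabilityMeasure P]
    (k : 𝕏 → 𝕏 → ℝ) (hk : (Matrix.of k).PosSemidef) (hk_meas : Measurable (Function.uncurry k))
    (σ : ℝ) (hσ : 0 < σ)
    (N : ℕ) (hN : 1 ≤ N)
    (x : Fin N → Ω → 𝕏) (hx : ∀ j, Measurable (x j))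
    (hindep : iIndepFun x P) (hident : ∀ i j, IdentDistrib (x i) (x j) P P)
    (Lplus : ℝ)
    (hL : ∀ᵐ ω ∂P, ∀ j, Real.log (k (x j ω) (x j ω) + σ ^ 2) ≤ Lplus)
    (r δ : ℝ) (hr : r ∈ Set.Ioo (0 : ℝ) 1) (hδ : δ ∈ Set.Ioo (0 : ℝ) 1) :
    IsStoppingTime (canonicalFiltration x hx)
      (fun ω => ((logDetStoppingStep k σ Lplus δ r (fun j => x j ω) : ℕ) : WithTop ℕ)) ∧
    P {ω | |Real.log (regularizedKernelMatrix k σ (fun j => x j ω)).det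
              - logDetEstimate k σ Lplus δ r (fun j => x j ω)|
            > r * |Real.log (regularizedKernelMatrix k σ (fun j => x j ω)).det|}
      ≤ ENNReal.ofReal δ := by
  set f : Fin N → Ω → ℝ := fun j ω => logDetSummand k σ (fun i => x i ω) j with hf
  have hfm : ∀ j : Fin N, StronglyMeasurable[canonicalFiltration x hx (j + 1)] (f j) :=
    stronglyMeasurable_logDetSummand hx hk hσ hk_meas
  have hlow : ∀ ω j, Real.log (σ ^ 2) ≤ f j ω := fun ω j => le_logDetSummand hk hσ _ j
  have hfab : ∀ j, ∀ᵐ ω ∂P, f j ω ∈ Set.Icc (Real.log (σ ^ 2)) Lplus := fun j =>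
    hL.mono fun ω hω => ⟨hlow ω j, (logDetSummand_le hk hσ _ j).trans (hω j)⟩
  have hab : Real.log (σ ^ 2) ≤ Lplus := by
    obtain ⟨ω, hω⟩ := (hfab ⟨0, hN⟩).exists
    exact hω.1.trans hω.2
  have hb : ∀ j, ∀ᵐ y ∂(P.map (x j)), Real.log (k y y + σ ^ 2) ≤ Lplus := fun j =>
    (ae_map_iff (hx j).aemeasurable (measurableSet_le (Real.measurable_log.comp
      ((hk_meas.comp (measurable_id.prodMk measurable_id)).add_const _)) measurable_const)).2
      (hL.mono fun ω hω => hω j)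
  have hτ := measurableSet_stoppingStep_le hfm (Real.log (σ ^ 2)) Lplus δ r
  refine ⟨fun n => ?_, ?_⟩
  · refine (congrArg (MeasurableSet[canonicalFiltration x hx n])
      (Set.ext fun ω => ?_)).mpr (hτ n)
    exact WithTop.coe_le_coe
  · refine (measure_mono fun ω hω => ?_).trans (measure_upperBound_lt_partialSum_le hN hab hfm hfab
      (fun i j hij => condExp_logDetSummand_le hx hk hσ hk_meas hindep hident hb hij) hτ
      (fun ω => one_le_stoppingStep hN _ _ _ _ _) (fun ω => stoppingStep_le _ _ _ _ _) hδ.1.le)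
    rw [Set.mem_ofPred_eq, log_det_regularizedKernelMatrix hk hσ] at hω
    -- Failure of the error bound forces `U_τ < D_N`, since the lower bound always holds.
    by_contra hnot
    exact (abs_sub_estimator_stoppingStep_le hab (hlow ω) hr.1.le (not_lt.1 hnot)).not_gt hω
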